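/- Let $N\ge 1$, let $\Omega\subset\mathbb{R}^N$ be a bounded open set and let $2\le p<\infty$. For $k\in\mathbb{N}$ let $\mathcal{F}_k:[0,\infty)\to[0,\infty)$ be a non-decreasing $C^1$ function such that $\mathcal{F}_k(t)=t$ for $t\in[0,k^2]$, $\mathcal{F}_k(t)=k^2+1$ for $t>k^2+1$, and, for some $\delta\in(0,1)$, $t\le\mathcal{F}_k(t)\le t+\delta$ for $k^2\le t<k^2+1$. Let $H_0^1(\Omega)$ be the closure of $C_0^\infty(\Omega)$ in $H^1(\Omega)$, with the norm $\|y\|_{H_0^1(\Omega)}=\|\nabla y\|_{L^2(\Omega)^N}$, and for $\varepsilon>0$ put $$F_{\varepsilon,k}(y,z)=\left[\varepsilon+\mathcal{F}_k(|y|^2)\right]^{\frac{p-2}{2}}y+\left[\varepsilon+\mathcal{F}_k(|z|^2)\right]^{\frac{p-2}{2}}z,\qquad y\in H_0^1(\Omega),\ z\in L^2(\Omega).$$ Then for every $k\in\mathbb{N}$ and $\varepsilon>0$: (1) the operator $F_{\varepsilon,k}:H_0^1(\Omega)\times L^2(\Omega)\to L^2(\Omega)$ is bounded, i.e. it maps bounded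 sets to bounded sets; (2) for every $y\in H_0^1(\Omega)$ the operator $F_{\varepsilon,k}(y,\cdot):L^2(\Omega)\to L^2(\Omega)$ is strictly monotone, i.e. for all $z_1,z_2\in L^2(\Omega)$ one has $\int_\Omega\big(F_{\varepsilon,k}(y,z_1)-F_{\varepsilon,k}(y,z_2)\big)(z_1-z_2)\,dx\ge 0$, with equality only if $z_1=z_2$; and it is radially continuous, i.e. for all $z_1,z_2\in L^2(\Omega)$ there is $\tau_0>0$ such that $\tau\mapsto\int_\Omega F_{\varepsilon,k}(y,z_1+\tau z_2)\,z_2\,dx$ is continuous on $[0,\tau_0]$; (3) for every $z\in L^2(\Omega)$ the operator $F_{\varepsilon,k}(\cdot,z):H_0^1(\Omega)\to L^2(\Omega)$ is compact in the following sense: if $y_n\rightharpoonup y_0$ weakly in $H_0^1(\Omega)$, then $F_{\varepsilon,k}(y_n,z)\to F_{\varepsilon,k}(y_0,z)$ strongly in $L^2(\Omega)$ as $n\to\infty$. -/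

import Mathlib

open MeasureTheory Filter Topology Set
open scoped ContDiff

/-- The real Lebesgue space `L²(Ω)`. -/
abbrev L2 {N : ℕ} (Ω : Set (EuclideanSpace ℝ (Fin N))) : Type :=
  Lp ℝ 2 (volume.restrict Ω)

/-- The space `L²(Ω)^N` of square integrable vector fields. -/
abbrev L2Vec {N : ℕ} (Ω : Set (EuclideanSpace ℝ (Fin N))) : Type :=
  Lp (EuclideanSpace ℝ (Fin N)) 2 (volume.restrict Ω)

/-- `φ ∈ C₀^∞(Ω)`. -/
structure IsTestFunction {N : ℕ} (Ω : Set (EuclideanSpace ℝ (Fin N)))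
    (φ : EuclideanSpace ℝ (Fin N) → ℝ) : Prop where
  smooth : ContDiff ℝ ∞ φ
  compactSupport : HasCompactSupport φ
  support_subset : tsupport φ ⊆ Ω

/-- The closure of `{(φ, ∇φ) : φ ∈ C₀^∞(Ω)}` in `L²(Ω) × L²(Ω)^N`. Its elements are the pairs
`(y, ∇y)` of a function `y ∈ H₀¹(Ω)` and its weak gradient. The set of pairs `(φ, ∇φ)` is itself
a linear subspace, so that taking its span adds nothing. -/
noncomputable def H01Submodule {N : ℕ} (Ω : Set (EuclideanSpace ℝ (Fin N))) :
    Submodule ℝ (L2 Ω × L2Vec Ω) :=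
  (Submodule.span ℝ {w : L2 Ω × L2Vec Ω | ∃ φ : EuclideanSpace ℝ (Fin N) → ℝ,
    IsTestFunction Ω φ ∧ w.1 =ᵐ[volume.restrict Ω] φ ∧
      w.2 =ᵐ[volume.restrict Ω] gradient φ}).topologicalClosure

/-- The Sobolev space `H₀¹(Ω)`. -/
def H01 {N : ℕ} (Ω : Set (EuclideanSpace ℝ (Fin N))) : Type :=
  ↥(H01Submodule Ω)

namespace H01

variable {N : ℕ} {Ω : Set (EuclideanSpace ℝ (Fin N))}

noncomputable instance : AddCommGroup (H01 Ω) :=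
  inferInstanceAs (AddCommGroup ↥(H01Submodule Ω))

noncomputable instance : Module ℝ (H01 Ω) :=
  inferInstanceAs (Module ℝ ↥(H01Submodule Ω))

/-- The embedding `H₀¹(Ω) → L²(Ω)`, `y ↦ y`. -/
noncomputable def toL2 : H01 Ω →ₗ[ℝ] L2 Ω :=
  (LinearMap.fst ℝ (L2 Ω) (L2Vec Ω)).comp (H01Submodule Ω).subtype

/-- The weak gradient `H₀¹(Ω) → L²(Ω)^N`, `y ↦ ∇y`. -/
noncomputable def grad : H01 Ω →ₗ[ℝ] L2Vec Ω :=
  (LinearMap.snd ℝ (L2 Ω) (L2Vec Ω)).comp (H01Submodule Ω).subtype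

/-- `H₀¹(Ω)` carries `‖y‖ = ‖∇y‖_{L²(Ω)^N}`. For bounded `Ω` and `N ≥ 1` this is a norm,
equivalent to the norm of `H¹(Ω)`, by Friedrichs' inequality. -/
noncomputable instance : SeminormedAddCommGroup (H01 Ω) :=
  SeminormedAddCommGroup.induced (H01 Ω) (L2Vec Ω) (grad (Ω := Ω))

noncomputable instance : NormedSpace ℝ (H01 Ω) :=
  NormedSpace.induced ℝ (H01 Ω) (L2Vec Ω) (grad (Ω := Ω))

end H01

/-- A (nonlinear) operator is bounded if it maps bounded sets to bounded sets. -/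
def IsBoundedOperator {X Y : Type*} [Bornology X] [Bornology Y] (G : X → Y) : Prop :=
  ∀ S : Set X, Bornology.IsBounded S → Bornology.IsBounded (G '' S)

/-- Strict monotonicity of `G : Z → Z* = Z` on a real Hilbert space:
`⟨G z₁ - G z₂, z₁ - z₂⟩ ≥ 0`, with equality only if `z₁ = z₂`. -/
def IsStrictlyMonotoneOperator {Z : Type*} [NormedAddCommGroup Z] [InnerProductSpace ℝ Z]
    (G : Z → Z) : Prop :=
  ∀ z₁ z₂ : Z, 0 ≤ inner ℝ (G z₁ - G z₂) (z₁ - z₂) ∧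
    (inner ℝ (G z₁ - G z₂) (z₁ - z₂) = 0 → z₁ = z₂)

/-- Radial continuity of an everywhere defined `G : Z → Z* = Z` on a real Hilbert space. -/
def IsRadiallyContinuous {Z : Type*} [NormedAddCommGroup Z] [InnerProductSpace ℝ Z]
    (G : Z → Z) : Prop :=
  ∀ z₁ z₂ : Z, ∃ ε : ℝ, 0 < ε ∧
    ContinuousOn (fun τ : ℝ => inner ℝ (G (z₁ + τ • z₂)) z₂) (Icc 0 ε)

/-- Weak convergence `y n ⇀ y₀` of a sequence. -/
def WeaklyConverges {E : Type*} [SeminormedAddCommGroup E] [NormedSpace ℝ E]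
    (y : ℕ → E) (y₀ : E) : Prop :=
  ∀ l : StrongDual ℝ E, Tendsto (fun n => l (y n)) atTop (𝓝 (l y₀))

/-- The requirements on the truncation `𝓕ₖ : ℝ₊ → ℝ₊`; only its values on `[0, ∞)` matter. -/
structure IsTruncation (k : ℕ) (Φ : ℝ → ℝ) : Prop where
  nonneg : ∀ t, 0 ≤ t → 0 ≤ Φ t
  monotone : MonotoneOn Φ (Ici 0)
  contDiff : ContDiffOn ℝ 1 Φ (Ici 0)
  eq_self : ∀ t ∈ Icc (0 : ℝ) ((k : ℝ) ^ 2), Φ t = t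
  eq_const : ∀ t, (k : ℝ) ^ 2 + 1 < t → Φ t = (k : ℝ) ^ 2 + 1
  between : ∃ δ ∈ Ioo (0 : ℝ) 1, ∀ t ∈ Ico ((k : ℝ) ^ 2) ((k : ℝ) ^ 2 + 1),
    t ≤ Φ t ∧ Φ t ≤ t + δ

/-- The scalar function `s ↦ [ε + 𝓕(|s|²)]^{(p-2)/2} s`. -/
noncomputable def regPower (p ε : ℝ) (Φ : ℝ → ℝ) (s : ℝ) : ℝ :=
  (ε + Φ (|s| ^ 2)) ^ ((p - 2) / 2) * s

theorem IsTruncation.le {k : ℕ} {Φ : ℝ → ℝ} (hΦ : IsTruncation k Φ) {t : ℝ} (ht : 0 ≤ t) :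
    Φ t ≤ (k : ℝ) ^ 2 + 1 := by
  have h : (0 : ℝ) ≤ max t ((k : ℝ) ^ 2 + 2) := le_max_of_le_left ht
  rw [← hΦ.eq_const (max t ((k : ℝ) ^ 2 + 2)) (lt_max_of_lt_right (by linarith))]
  exact hΦ.monotone ht h (le_max_left _ _)

theorem IsTruncation.continuous_regPower {k : ℕ} {Φ : ℝ → ℝ} (hΦ : IsTruncation k Φ)
    {p ε : ℝ} (hε : 0 < ε) : Continuous (regPower p ε Φ) := by
  have h : Continuous fun s : ℝ => Φ (|s| ^ 2) :=
    hΦ.contDiff.continuousOn.comp_continuous (by fun_prop) fun s => by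
      simp only [mem_Ici]; positivity
  refine Continuous.mul (Continuous.rpow_const (continuous_const.add h) fun s => Or.inl ?_) continuous_id
  have := hΦ.nonneg (|s| ^ 2) (by positivity)
  linarith

theorem IsTruncation.memLp_regPower {k : ℕ} {Φ : ℝ → ℝ} (hΦ : IsTruncation k Φ) {p ε : ℝ}
    (hp : 2 ≤ p) (hε : 0 < ε) {α : Type*} [MeasurableSpace α] {μ : Measure α} {u : α → ℝ}
    (hu : MemLp u 2 μ) : MemLp (fun x => regPower p ε Φ (u x)) 2 μ := by
  refine MemLp.of_le_mul (c := (ε + ((k : ℝ) ^ 2 + 1)) ^ ((p - 2) / 2)) hu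
    ((hΦ.continuous_regPower hε).comp_aestronglyMeasurable hu.1) (ae_of_all _ fun x => ?_)
  have h0 := hΦ.nonneg (|u x| ^ 2) (by positivity)
  have h1 := hΦ.le (t := |u x| ^ 2) (by positivity)
  have h2 : 0 ≤ ε + Φ (|u x| ^ 2) := by linarith
  rw [regPower, norm_mul, Real.norm_of_nonneg (Real.rpow_nonneg h2 _)]
  gcongr

/-- The operator `F_{ε,k} : H₀¹(Ω) × L²(Ω) → L²(Ω)`,
`F_{ε,k}(y, z) = [ε + 𝓕ₖ(|y|²)]^{(p-2)/2} y + [ε + 𝓕ₖ(|z|²)]^{(p-2)/2} z`. -/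
noncomputable def FOperator {N : ℕ} {Ω : Set (EuclideanSpace ℝ (Fin N))} {p ε : ℝ} {k : ℕ}
    {Φ : ℝ → ℝ} (hp : 2 ≤ p) (hε : 0 < ε) (hΦ : IsTruncation k Φ)
    (y : H01 Ω) (z : L2 Ω) : L2 Ω :=
  MemLp.toLp (fun x => regPower p ε Φ (H01.toL2 y x) + regPower p ε Φ (z x))
    ((hΦ.memLp_regPower hp hε (Lp.memLp (H01.toL2 y))).add
      (hΦ.memLp_regPower hp hε (Lp.memLp z)))

/-! ### The scalar nonlinearity -/

namespace IsTruncation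

variable {k : ℕ} {Φ : ℝ → ℝ} {p ε : ℝ}

/-! Everything rests on the scalar function `regPower`. Truncation makes it linear for large
arguments, so it is globally Lipschitz (`exists_lipschitzWith_regPower`); it is also strictly
increasing and vanishes at `0`. Its superposition operator is therefore Lipschitz on `L²`, with at
most linear growth, and strictly monotone. Radial continuity follows at once, and boundedness
follows once Friedrichs' inequality controls `‖y‖₂` by `‖∇y‖₂`. For compactness it suffices that
weak convergence in `H₀¹` gives strong convergence in `L²` (Rellich,
`WeaklyConverges.tendsto_toL2`). Both Sobolev facts come from the translation estimate for `C¹`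
functions. For Rellich, a test function is `L²`-close to its averages over small balls, uniformly
for bounded gradients, while weak convergence sends each average to zero. -/

theorem contDiff_regPower (hΦ : IsTruncation k Φ) (hε : 0 < ε) :
    ContDiff ℝ 1 (regPower p ε Φ) := by
  have h : ContDiff ℝ 1 fun s : ℝ => Φ (|s| ^ 2) := by
    simp only [sq_abs]
    rw [← contDiffOn_univ]
    refine hΦ.contDiff.comp (contDiff_id.pow 2).contDiffOn fun s _ => ?_
    simpa using sq_nonneg s
  refine ContDiff.mul (ContDiff.rpow_const_of_ne (contDiff_const.add h) fun s => ?_) contDiff_id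
  have := hΦ.nonneg (|s| ^ 2) (by positivity)
  linarith

/-- Beyond the truncation level the function equals `c * s`; what remains is `C¹` with compact
support, hence Lipschitz. -/
theorem exists_lipschitzWith_regPower (hΦ : IsTruncation k Φ) (hε : 0 < ε) :
    ∃ C, LipschitzWith C (regPower p ε Φ) := by
  set c : ℝ := (ε + ((k : ℝ) ^ 2 + 1)) ^ ((p - 2) / 2)
  have hsupp : HasCompactSupport fun s => regPower p ε Φ s - c * s := by
    -- `(k + 1)² ≥ k² + 1`, so outside this ball `|s|²` is in the range where `Φ` is constant.
    refine HasCompactSupport.intro (isCompact_closedBall (0 : ℝ) (k + 1)) fun s hs => ?_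
    have hs : (k : ℝ) + 1 < |s| := by simpa using hs
    have hk : (0 : ℝ) ≤ k := k.cast_nonneg
    rw [regPower, hΦ.eq_const _ (by nlinarith), sub_self]
  obtain ⟨C, hC⟩ := ContDiff.lipschitzWith_of_hasCompactSupport (𝕂 := ℝ) hsupp
    ((hΦ.contDiff_regPower hε).sub (contDiff_const.mul contDiff_id)) one_ne_zero
  have hlin : LipschitzWith ‖c‖₊ fun s : ℝ => c * s :=
    LipschitzWith.of_dist_le_mul fun s t => by
      simp [dist_eq_norm, ← mul_sub]
  exact ⟨C + ‖c‖₊, by simpa using hC.add hlin⟩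

theorem strictMono_regPower (hΦ : IsTruncation k Φ) (hp : 2 ≤ p) (hε : 0 < ε) :
    StrictMono (regPower p ε Φ) := by
  refine strictMono_of_odd_strictMonoOn_nonneg (fun s => by simp [regPower]) ?_
  intro s hs t _ hst
  have hs : 0 ≤ s := hs
  have hmono : Φ (|s| ^ 2) ≤ Φ (|t| ^ 2) :=
    hΦ.monotone (mem_Ici.2 (by positivity)) (mem_Ici.2 (by positivity)) (by
      rw [abs_of_nonneg hs, abs_of_nonneg (hs.trans hst.le)]
      gcongr)
  have h0 := hΦ.nonneg (|s| ^ 2) (by positivity)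
  have hpos : 0 < (ε + Φ (|t| ^ 2)) ^ ((p - 2) / 2) := Real.rpow_pos_of_pos (by linarith) _
  calc regPower p ε Φ s ≤ (ε + Φ (|t| ^ 2)) ^ ((p - 2) / 2) * s := by
        rw [regPower]
        gcongr
    _ < regPower p ε Φ t := by
        rw [regPower]
        gcongr

end IsTruncation

/-! ### Superposition operators on `L²` -/

theorem regPower_zero {p ε : ℝ} {Φ : ℝ → ℝ} : regPower p ε Φ 0 = 0 := by
  simp [regPower]

/-- The superposition operator of a strictly increasing function is strictly monotone on `L²`. -/
theorem isStrictlyMonotoneOperator_of_strictMono {α : Type*} [MeasurableSpace α] {μ : Measure α}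
    {f : ℝ → ℝ} (hf : StrictMono f) {G : Lp ℝ 2 μ → Lp ℝ 2 μ}
    (hG : ∀ z₁ z₂, ⇑(G z₁ - G z₂) =ᵐ[μ] fun x => f (z₁ x) - f (z₂ x)) :
    IsStrictlyMonotoneOperator G := by
  intro z₁ z₂
  have hfun : (fun x => inner ℝ ((G z₁ - G z₂ : Lp ℝ 2 μ) x) ((z₁ - z₂ : Lp ℝ 2 μ) x)) =ᵐ[μ]
      fun x => (z₁ x - z₂ x) * (f (z₁ x) - f (z₂ x)) := by
    filter_upwards [hG z₁ z₂, Lp.coeFn_sub z₁ z₂] with x h1 h2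
    rw [h1, h2, Pi.sub_apply]
    rfl
  have hnonneg : ∀ a b : ℝ, 0 ≤ (a - b) * (f a - f b) := fun a b => by
    rcases le_total a b with h | h
    · exact mul_nonneg_of_nonpos_of_nonpos (sub_nonpos.2 h) (sub_nonpos.2 (hf.monotone h))
    · exact mul_nonneg (sub_nonneg.2 h) (sub_nonneg.2 (hf.monotone h))
  rw [L2.inner_def, integral_congr_ae hfun]
  refine ⟨integral_nonneg fun x => hnonneg _ _, fun h => ?_⟩
  rw [integral_eq_zero_iff_of_nonneg (fun x => hnonneg _ _)
    ((integrable_congr hfun).1 (L2.integrable_inner _ _))] at h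
  refine Lp.ext ?_
  filter_upwards [h] with x hx
  rcases mul_eq_zero.1 hx with h | h
  · exact sub_eq_zero.1 h
  · exact hf.injective (sub_eq_zero.1 h)

theorem IsRadiallyContinuous.of_continuous {Z : Type*} [NormedAddCommGroup Z]
    [InnerProductSpace ℝ Z] {G : Z → Z} (hG : Continuous G) : IsRadiallyContinuous G :=
  fun z₁ z₂ => ⟨1, one_pos, Continuous.continuousOn (by fun_prop)⟩

theorem FOperator_eq_compLp {N : ℕ} {Ω : Set (EuclideanSpace ℝ (Fin N))} {p ε : ℝ} {k : ℕ}
    {Φ : ℝ → ℝ} (hp : 2 ≤ p) (hε : 0 < ε) (hΦ : IsTruncation k Φ) {C : NNReal}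
    (hC : LipschitzWith C (regPower p ε Φ)) (y : H01 Ω) (z : L2 Ω) :
    FOperator hp hε hΦ y z =
      hC.compLp regPower_zero (H01.toL2 y) + hC.compLp regPower_zero z := by
  refine Lp.ext ?_
  filter_upwards [MemLp.coeFn_toLp ((hΦ.memLp_regPower hp hε (Lp.memLp (H01.toL2 y))).add
      (hΦ.memLp_regPower hp hε (Lp.memLp z))),
    Lp.coeFn_add (hC.compLp regPower_zero (H01.toL2 y)) (hC.compLp regPower_zero z),
    hC.coeFn_compLp regPower_zero (H01.toL2 y), hC.coeFn_compLp regPower_zero z] with x h1 h2 h3 h4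
  rw [h2, Pi.add_apply, h3, h4]
  exact h1

/-! ### Translation estimates, Friedrichs and Rellich for smooth functions -/

theorem sq_lintegral_le_lintegral_sq {α : Type*} [MeasurableSpace α] {P : Measure α}
    [IsProbabilityMeasure P] {f : α → ENNReal} (hf : AEMeasurable f P) :
    (∫⁻ a, f a ∂P) ^ 2 ≤ ∫⁻ a, f a ^ 2 ∂P := by
  have h := ENNReal.lintegral_mul_le_Lp_mul_Lq P Real.HolderConjugate.two_two hf
    (aemeasurable_const (b := (1 : ENNReal)))
  simp only [Pi.mul_apply, mul_one, ENNReal.one_rpow, lintegral_const, measure_univ] at h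
  calc (∫⁻ a, f a ∂P) ^ 2 ≤ ((∫⁻ a, f a ^ (2 : ℝ) ∂P) ^ (1 / 2 : ℝ)) ^ 2 := by gcongr
    _ = ∫⁻ a, f a ^ 2 ∂P := by
      rw [← ENNReal.rpow_natCast, ← ENNReal.rpow_mul]
      simp

/-- Fundamental theorem of calculus along the segment, then Cauchy–Schwarz in `t`. -/
theorem enorm_sub_sq_le_lintegral_fderiv {E : Type*} [NormedAddCommGroup E] [NormedSpace ℝ E]
    {φ : E → ℝ} (hφ : ContDiff ℝ 1 φ) (x h : E) :
    ‖φ (x + h) - φ x‖ₑ ^ 2 ≤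
      ‖h‖ₑ ^ 2 * ∫⁻ t in Ioc (0 : ℝ) 1, ‖fderiv ℝ φ (x + t • h)‖ₑ ^ 2 := by
  have hcont : Continuous fun t : ℝ => fderiv ℝ φ (x + t • h) :=
    (hφ.continuous_fderiv one_ne_zero).comp (by fun_prop)
  have hderiv : ∀ t ∈ uIcc (0 : ℝ) 1,
      HasDerivAt (fun t : ℝ => φ (x + t • h)) (fderiv ℝ φ (x + t • h) h) t := fun t _ => by
    have h1 : HasDerivAt (fun t : ℝ => x + t • h) h t := by
      simpa using ((hasDerivAt_id t).smul_const h).const_add x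
    exact ((hφ.differentiable one_ne_zero) _).hasFDerivAt.comp_hasDerivAt t h1
  have hint := intervalIntegral.integral_eq_sub_of_hasDerivAt hderiv
    ((hcont.clm_apply (continuous_const (y := h))).intervalIntegrable 0 1)
  simp only [one_smul, zero_smul, add_zero] at hint
  have : IsProbabilityMeasure (volume.restrict (Ioc (0 : ℝ) 1)) := ⟨by simp⟩
  have hmeas : Measurable fun t : ℝ => ‖fderiv ℝ φ (x + t • h)‖ₑ := hcont.enorm.measurable
  calc ‖φ (x + h) - φ x‖ₑ ^ 2
      ≤ (∫⁻ t in Ioc (0 : ℝ) 1, ‖fderiv ℝ φ (x + t • h)‖ₑ * ‖h‖ₑ) ^ 2 := by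
        rw [← hint, intervalIntegral.integral_of_le zero_le_one]
        gcongr
        refine (enorm_integral_le_lintegral_enorm _).trans (lintegral_mono fun t => ?_)
        exact ContinuousLinearMap.le_opENorm _ _
    _ = ‖h‖ₑ ^ 2 * (∫⁻ t in Ioc (0 : ℝ) 1, ‖fderiv ℝ φ (x + t • h)‖ₑ) ^ 2 := by
        rw [lintegral_mul_const _ hmeas, mul_pow, mul_comm]
    _ ≤ _ := by
        gcongr
        exact sq_lintegral_le_lintegral_sq hmeas.aemeasurable

section Smooth

variable {E : Type*} [NormedAddCommGroup E] [NormedSpace ℝ E] [FiniteDimensional ℝ E]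
  [MeasurableSpace E] [BorelSpace E] {μ : Measure E} [μ.IsAddHaarMeasure]

/-- The translation estimate `‖φ(· + h) - φ‖₂ ≤ |h| ‖∇φ‖₂`. -/
theorem lintegral_translate_sub_sq_le {φ : E → ℝ} (hφ : ContDiff ℝ 1 φ) (h : E) :
    ∫⁻ x, ‖φ (x + h) - φ x‖ₑ ^ 2 ∂μ ≤ ‖h‖ₑ ^ 2 * ∫⁻ x, ‖fderiv ℝ φ x‖ₑ ^ 2 ∂μ := by
  have hcont : Continuous (fderiv ℝ φ) := hφ.continuous_fderiv one_ne_zero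
  have hmeas : Measurable fun z : E × ℝ => ‖fderiv ℝ φ (z.1 + z.2 • h)‖ₑ ^ 2 :=
    (hcont.comp (by fun_prop)).enorm.measurable.pow_const 2
  calc ∫⁻ x, ‖φ (x + h) - φ x‖ₑ ^ 2 ∂μ
      ≤ ∫⁻ x, (‖h‖ₑ ^ 2 * ∫⁻ t in Ioc (0 : ℝ) 1, ‖fderiv ℝ φ (x + t • h)‖ₑ ^ 2) ∂μ :=
        lintegral_mono fun x => enorm_sub_sq_le_lintegral_fderiv hφ x h
    _ = ‖h‖ₑ ^ 2 * ∫⁻ t in Ioc (0 : ℝ) 1, (∫⁻ x, ‖fderiv ℝ φ (x + t • h)‖ₑ ^ 2 ∂μ) := by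
        rw [lintegral_const_mul _ hmeas.lintegral_prod_right', lintegral_lintegral_swap
          (f := fun (x : E) (t : ℝ) => ‖fderiv ℝ φ (x + t • h)‖ₑ ^ 2) hmeas.aemeasurable]
    _ = ‖h‖ₑ ^ 2 * ∫⁻ x, ‖fderiv ℝ φ x‖ₑ ^ 2 ∂μ := by
        simp_rw [fun t : ℝ => lintegral_add_right_eq_self (μ := μ)
          (fun x => ‖fderiv ℝ φ x‖ₑ ^ 2) (t • h)]
        simp

/-- A function is `L²`-close to its average over small translations. -/
theorem lintegral_sub_average_sq_le {φ : E → ℝ} (hφ : ContDiff ℝ 1 φ) (hc : HasCompactSupport φ)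
    {P : Measure E} [IsProbabilityMeasure P] {δ : ENNReal} (hP : ∀ᵐ h ∂P, ‖h‖ₑ ≤ δ) :
    ∫⁻ x, ‖φ x - ∫ h, φ (x + h) ∂P‖ₑ ^ 2 ∂μ ≤ δ ^ 2 * ∫⁻ x, ‖fderiv ℝ φ x‖ₑ ^ 2 ∂μ := by
  have hmeas : Measurable fun z : E × E => ‖φ (z.1 + z.2) - φ z.1‖ₑ ^ 2 :=
    (((hφ.continuous.comp (by fun_prop)).sub
      (hφ.continuous.comp continuous_fst)).enorm.measurable).pow_const 2
  have hpt : ∀ x, ‖φ x - ∫ h, φ (x + h) ∂P‖ₑ ^ 2 ≤ ∫⁻ h, ‖φ (x + h) - φ x‖ₑ ^ 2 ∂P := fun x => by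
    have hi : Integrable (fun h => φ (x + h)) P :=
      (hφ.continuous.comp (by fun_prop)).integrable_of_hasCompactSupport
        (hc.comp_homeomorph (Homeomorph.addLeft x))
    have heq : φ x - ∫ h, φ (x + h) ∂P = -∫ h, (φ (x + h) - φ x) ∂P := by
      rw [integral_sub hi (integrable_const _)]
      simp
    rw [heq, enorm_neg]
    refine (pow_le_pow_left₀ zero_le (enorm_integral_le_lintegral_enorm _) 2).trans ?_
    exact sq_lintegral_le_lintegral_sq
      ((hφ.continuous.comp (by fun_prop)).sub continuous_const).enorm.measurable.aemeasurable
  calc ∫⁻ x, ‖φ x - ∫ h, φ (x + h) ∂P‖ₑ ^ 2 ∂μ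
      ≤ ∫⁻ x, ∫⁻ h, ‖φ (x + h) - φ x‖ₑ ^ 2 ∂P ∂μ := lintegral_mono hpt
    _ = ∫⁻ h, ∫⁻ x, ‖φ (x + h) - φ x‖ₑ ^ 2 ∂μ ∂P :=
        lintegral_lintegral_swap
          (f := fun x h : E => ‖φ (x + h) - φ x‖ₑ ^ 2) hmeas.aemeasurable
    _ ≤ ∫⁻ _, δ ^ 2 * ∫⁻ x, ‖fderiv ℝ φ x‖ₑ ^ 2 ∂μ ∂P := by
        refine lintegral_mono_ae (hP.mono fun h hh => ?_)
        exact (lintegral_translate_sub_sq_le hφ h).trans (by gcongr)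
    _ = δ ^ 2 * ∫⁻ x, ‖fderiv ℝ φ x‖ₑ ^ 2 ∂μ := by simp

/-- Friedrichs' inequality. -/
theorem exists_lintegral_sq_le_lintegral_fderiv_sq [Nontrivial E] {Ω : Set E}
    (hΩ : Bornology.IsBounded Ω) : ∃ C : NNReal, ∀ φ : E → ℝ, ContDiff ℝ 1 φ →
      Function.support φ ⊆ Ω →
      ∫⁻ x, ‖φ x‖ₑ ^ 2 ∂μ ≤ C ^ 2 * ∫⁻ x, ‖fderiv ℝ φ x‖ₑ ^ 2 ∂μ := by
  obtain ⟨R, hR0, hR⟩ := hΩ.exists_pos_norm_le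
  -- A translation longer than the diameter moves `Ω` off itself, so `φ (x + h) - φ x = -φ x`
  -- wherever `φ x ≠ 0`.
  obtain ⟨h, hh⟩ := exists_norm_eq E (by positivity : 0 ≤ 2 * R + 1)
  refine ⟨‖h‖₊, fun φ hφ hs => le_trans (lintegral_mono fun x => ?_)
    (lintegral_translate_sub_sq_le hφ h)⟩
  by_cases hx : φ x = 0
  · simp [hx]
  have hxΩ := hR x (hs hx)
  have : φ (x + h) = 0 := by
    by_contra hne
    have h1 := hR _ (hs hne)
    have h2 : ‖h‖ ≤ ‖x + h‖ + ‖x‖ := by simpa using norm_sub_le (x + h) x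
    linarith
  simp [this]

/-- Rellich's theorem for smooth functions: a sequence with bounded gradients whose means over
balls tend to zero tends to zero in `L²`. -/
theorem tendsto_lintegral_sq_of_tendsto_integral_ball [Nontrivial E] {Ω : Set E}
    (hΩ : Bornology.IsBounded Ω) {φ : ℕ → E → ℝ} (hφ : ∀ n, ContDiff ℝ 1 (φ n))
    (hc : ∀ n, HasCompactSupport (φ n)) (hs : ∀ n, Function.support (φ n) ⊆ Ω)
    {K : NNReal} (hK : ∀ n, ∫⁻ x, ‖fderiv ℝ (φ n) x‖ₑ ^ 2 ∂μ ≤ K)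
    (hball : ∀ x δ, Tendsto (fun n => ∫ y in Metric.ball x δ, φ n y ∂μ) atTop (𝓝 0)) :
    Tendsto (fun n => ∫⁻ x, ‖φ n x‖ₑ ^ 2 ∂μ) atTop (𝓝 0) := by
  obtain ⟨C, hC⟩ := exists_lintegral_sq_le_lintegral_fderiv_sq (μ := μ) hΩ
  have hbd : ∀ n, ∫⁻ x, ‖φ n x‖ₑ ^ 2 ∂μ ≤ C ^ 2 * K := fun n =>
    (hC _ (hφ n) (hs n)).trans (by gcongr; exact hK n)
  refine ENNReal.tendsto_nhds_zero.2 fun η hη => ?_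
  -- The radius is fixed before `n`: the averaging error is at most `δ² K` for all `n`. The factor 2
  -- anticipates `(a + b)² ≤ 2a² + 2b²`.
  obtain ⟨δ, hδη, hδ⟩ : ∃ δ : ℝ, 2 * (ENNReal.ofReal δ ^ 2 * K) ≤ η / 2 ∧ 0 < δ := by
    have : Tendsto (fun δ : ℝ => 2 * (ENNReal.ofReal δ ^ 2 * K)) (𝓝[>] 0) (𝓝 0) := by
      have h1 : Tendsto (fun δ : ℝ => ENNReal.ofReal δ ^ 2 * K) (𝓝[>] 0) (𝓝 (0 * K)) := by
        refine ENNReal.Tendsto.mul_const ?_ (Or.inr ENNReal.coe_ne_top)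
        have := (((ENNReal.continuous_pow 2).comp ENNReal.continuous_ofReal).tendsto 0).mono_left
          (nhdsWithin_le_nhds (s := Ioi 0))
        simpa [Function.comp_def] using this
      simpa using ENNReal.Tendsto.const_mul h1 (Or.inr ENNReal.ofNat_ne_top)
    exact ((this.eventually_le_const (ENNReal.half_pos hη.ne')).and self_mem_nhdsWithin).exists
  set B := Metric.ball (0 : E) δ with hB
  have hB0 : μ B ≠ 0 := (Metric.measure_ball_pos μ 0 hδ).ne'
  have hBt : μ B ≠ ⊤ := measure_ball_lt_top.ne
  set P := ProbabilityTheory.cond μ B with hPdef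
  have : IsProbabilityMeasure P := ProbabilityTheory.cond_isProbabilityMeasure_of_finite hB0 hBt
  have hP : ∀ᵐ h ∂P, ‖h‖ₑ ≤ ENNReal.ofReal δ := by
    filter_upwards [ProbabilityTheory.ae_cond_mem measurableSet_ball] with h hh
    rw [← ofReal_norm]
    exact ENNReal.ofReal_le_ofReal (mem_ball_zero_iff.1 hh).le
  set A : ℕ → E → ℝ := fun n x => ∫ h, φ n (x + h) ∂P with hA
  have hmeasA : ∀ n, Measurable (A n) := fun n =>
    (StronglyMeasurable.integral_prod_right' (f := fun z : E × E => φ n (z.1 + z.2))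
      ((hφ n).continuous.comp (by fun_prop)).stronglyMeasurable).measurable
  have hAlim : ∀ x, Tendsto (fun n => A n x) atTop (𝓝 0) := fun x => by
    have heq : ∀ n, A n x = (μ B)⁻¹.toReal • ∫ y in Metric.ball x δ, φ n y ∂μ := fun n => by
      rw [hA, hPdef]
      simp only [ProbabilityTheory.cond, integral_smul_measure]
      congr 1
      have := (measurePreserving_add_left μ x).setIntegral_preimage_emb
        (measurableEmbedding_addLeft x) (φ n) (Metric.ball x δ)
      rw [← this]
      simp [hB]
    simp_rw [heq]
    simpa using (hball x δ).const_smul (μ B)⁻¹.toReal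
  -- Averaging turns the `L²` bound into a uniform pointwise one; this constant is integrable over
  -- the bounded set `Ω`, which permits dominated convergence.
  have hAbd : ∀ n x, ‖A n x‖ₑ ^ 2 ≤ (μ B)⁻¹ * (C ^ 2 * K) := fun n x => by
    have hm : Measurable fun h => ‖φ n (x + h)‖ₑ :=
      ((hφ n).continuous.comp (by fun_prop)).enorm.measurable
    calc ‖A n x‖ₑ ^ 2 ≤ (∫⁻ h, ‖φ n (x + h)‖ₑ ∂P) ^ 2 := by
          gcongr
          exact enorm_integral_le_lintegral_enorm _
      _ ≤ ∫⁻ h, ‖φ n (x + h)‖ₑ ^ 2 ∂P := sq_lintegral_le_lintegral_sq hm.aemeasurable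
      _ ≤ (μ B)⁻¹ * ∫⁻ h, ‖φ n (x + h)‖ₑ ^ 2 ∂μ := by
          rw [hPdef, ProbabilityTheory.cond, lintegral_smul_measure, smul_eq_mul]
          exact mul_le_mul_right (setLIntegral_le_lintegral _ _) _
      _ ≤ (μ B)⁻¹ * (C ^ 2 * K) := by
          rw [lintegral_add_left_eq_self (μ := μ) (fun y => ‖φ n y‖ₑ ^ 2) x]
          gcongr
          exact hbd n
  have hΩfin : μ Ω ≠ ⊤ := hΩ.measure_lt_top.ne
  have hAint : Tendsto (fun n => 2 * ∫⁻ x in Ω, ‖A n x‖ₑ ^ 2 ∂μ) atTop (𝓝 0) := by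
    have := tendsto_lintegral_of_dominated_convergence (μ := μ.restrict Ω)
      (F := fun n x => ‖A n x‖ₑ ^ 2) (f := fun _ => 0) (fun _ => (μ B)⁻¹ * (C ^ 2 * K))
      (fun n => (hmeasA n).enorm.pow_const 2) (fun n => ae_of_all _ (hAbd n))
      (by
        rw [lintegral_const, Measure.restrict_apply_univ]
        exact ENNReal.mul_ne_top (ENNReal.mul_ne_top (ENNReal.inv_ne_top.2 hB0)
          (ENNReal.mul_ne_top (by simp) ENNReal.coe_ne_top)) hΩfin)
      (ae_of_all _ fun x => by
        have := (((ENNReal.continuous_pow 2).comp continuous_enorm).tendsto _).comp (hAlim x)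
        simpa [Function.comp_def] using this)
    simpa using ENNReal.Tendsto.const_mul this (Or.inr (ENNReal.ofNat_ne_top (n := 2)))
  filter_upwards [hAint.eventually_le_const (ENNReal.half_pos hη.ne')] with n hn
  calc ∫⁻ x, ‖φ n x‖ₑ ^ 2 ∂μ = ∫⁻ x in Ω, ‖φ n x‖ₑ ^ 2 ∂μ := by
        refine (setLIntegral_eq_of_support_subset fun x hx => hs n ?_).symm
        simpa using hx
    _ ≤ ∫⁻ x in Ω, (2 * ‖φ n x - A n x‖ₑ ^ 2 + 2 * ‖A n x‖ₑ ^ 2) ∂μ := by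
        refine lintegral_mono fun x => ?_
        calc ‖φ n x‖ₑ ^ 2 ≤ (‖φ n x - A n x‖ₑ + ‖A n x‖ₑ) ^ 2 := by
              gcongr
              simpa using enorm_add_le (φ n x - A n x) (A n x)
          _ ≤ _ := by
              rw [← mul_add]
              simp only [enorm_eq_nnnorm]
              exact_mod_cast add_sq_le (a := ‖φ n x - A n x‖₊) (b := ‖A n x‖₊)
    _ = 2 * ∫⁻ x in Ω, ‖φ n x - A n x‖ₑ ^ 2 ∂μ + 2 * ∫⁻ x in Ω, ‖A n x‖ₑ ^ 2 ∂μ := by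
        rw [lintegral_add_right _ (((hmeasA n).enorm.pow_const 2).const_mul 2),
          lintegral_const_mul _ ((hmeasA n).enorm.pow_const 2),
          lintegral_const_mul 2 (f := fun x => ‖φ n x - A n x‖ₑ ^ 2)
            (((hφ n).continuous.measurable.sub (hmeasA n)).enorm.pow_const 2)]
    _ ≤ η / 2 + η / 2 := by
        gcongr
        refine le_trans ?_ hδη
        gcongr
        exact (setLIntegral_le_lintegral _ _).trans
          ((lintegral_sub_average_sq_le (hφ n) (hc n) hP).trans (by gcongr; exact hK n))
    _ = η := ENNReal.add_halves η

end Smooth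

/-! ### Passage from test functions to `H₀¹(Ω)` -/

theorem eLpNorm_two_sq {α F : Type*} [MeasurableSpace α] {μ : Measure α} [NormedAddCommGroup F]
    (f : α → F) : eLpNorm f 2 μ ^ 2 = ∫⁻ x, ‖f x‖ₑ ^ 2 ∂μ := by
  simpa using eLpNorm_nnreal_pow_eq_lintegral (μ := μ) (f := f) (p := 2) two_ne_zero

section Sobolev

variable {N : ℕ} {Ω : Set (EuclideanSpace ℝ (Fin N))}

/-- `w = (φ, ∇φ)` with `φ ∈ C₀^∞(Ω)`. -/
def IsTestPair (φ : EuclideanSpace ℝ (Fin N) → ℝ) (w : L2 Ω × L2Vec Ω) : Prop :=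
  IsTestFunction Ω φ ∧ w.1 =ᵐ[volume.restrict Ω] φ ∧ w.2 =ᵐ[volume.restrict Ω] gradient φ

namespace IsTestFunction

variable {φ ψ : EuclideanSpace ℝ (Fin N) → ℝ}

theorem differentiable (hφ : IsTestFunction Ω φ) : Differentiable ℝ φ :=
  hφ.smooth.differentiable (by simp)

theorem zero : IsTestFunction Ω (0 : EuclideanSpace ℝ (Fin N) → ℝ) :=
  ⟨contDiff_const, HasCompactSupport.zero, by simp [tsupport]⟩

theorem add (hφ : IsTestFunction Ω φ) (hψ : IsTestFunction Ω ψ) : IsTestFunction Ω (φ + ψ) :=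
  ⟨hφ.smooth.add hψ.smooth, hφ.compactSupport.add hψ.compactSupport,
    (tsupport_add φ ψ).trans (union_subset hφ.support_subset hψ.support_subset)⟩

theorem const_smul (hφ : IsTestFunction Ω φ) (a : ℝ) : IsTestFunction Ω (a • φ) :=
  ⟨hφ.smooth.const_smul a, hφ.compactSupport.smul_left (f := fun _ => a),
    (tsupport_smul_subset_right (fun _ => a) φ).trans hφ.support_subset⟩

end IsTestFunction

/-- Test pairs are stable under linear operations, so elements of `H01Submodule` are limits of
single test pairs. -/
theorem exists_isTestPair_of_mem_span {w : L2 Ω × L2Vec Ω}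
    (hw : w ∈ Submodule.span ℝ {w : L2 Ω × L2Vec Ω | ∃ φ, IsTestPair φ w}) :
    ∃ φ, IsTestPair φ w := by
  induction hw using Submodule.span_induction with
  | mem w hw => exact hw
  | zero =>
    refine ⟨0, IsTestFunction.zero, Lp.coeFn_zero _ _ _, (Lp.coeFn_zero _ _ _).trans ?_⟩
    refine ae_of_all _ fun x => ?_
    simp [gradient]
  | add v w _ _ hv hw =>
    obtain ⟨φ, hφ, h1, h2⟩ := hv
    obtain ⟨ψ, hψ, h3, h4⟩ := hw
    refine ⟨φ + ψ, hφ.add hψ, (Lp.coeFn_add _ _).trans (h1.add h3),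
      (Lp.coeFn_add _ _).trans ((h2.add h4).trans (ae_of_all _ fun x => ?_))⟩
    simp only [gradient, Pi.add_apply]
    rw [fderiv_add (hφ.differentiable x) (hψ.differentiable x), map_add]
  | smul a w _ hw =>
    obtain ⟨φ, hφ, h1, h2⟩ := hw
    refine ⟨a • φ, hφ.const_smul a, (Lp.coeFn_smul _ _).trans (h1.const_smul a),
      (Lp.coeFn_smul _ _).trans ((h2.const_smul a).trans (ae_of_all _ fun x => ?_))⟩
    simp only [gradient, Pi.smul_apply]
    rw [fderiv_const_smul (hφ.differentiable x)]
    simp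

theorem mem_closure_isTestPair {w : L2 Ω × L2Vec Ω} (hw : w ∈ H01Submodule Ω) :
    w ∈ closure {w : L2 Ω × L2Vec Ω | ∃ φ, IsTestPair φ w} :=
  closure_mono (fun _ h => exists_isTestPair_of_mem_span h) hw

namespace IsTestPair

variable {φ : EuclideanSpace ℝ (Fin N) → ℝ} {w : L2 Ω × L2Vec Ω}

theorem enorm_fst_sq (hw : IsTestPair φ w) : ‖w.1‖ₑ ^ 2 = ∫⁻ x, ‖φ x‖ₑ ^ 2 := by
  rw [Lp.enorm_def, eLpNorm_congr_ae hw.2.1, eLpNorm_restrict_eq_of_support_subset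
    ((subset_tsupport _).trans hw.1.support_subset), eLpNorm_two_sq]

theorem enorm_snd_sq (hw : IsTestPair φ w) : ‖w.2‖ₑ ^ 2 = ∫⁻ x, ‖fderiv ℝ φ x‖ₑ ^ 2 := by
  have hs : Function.support (gradient φ) ⊆ Ω := fun x hx => by
    refine hw.1.support_subset (support_fderiv_subset ℝ fun h => hx ?_)
    simp [gradient, h]
  rw [Lp.enorm_def, eLpNorm_congr_ae hw.2.2, eLpNorm_restrict_eq_of_support_subset hs,
    eLpNorm_two_sq]
  simp [gradient, enorm_eq_nnnorm]

end IsTestPair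

/-- Friedrichs' inequality in `H₀¹(Ω)`. -/
theorem exists_norm_fst_le_norm_snd (hN : 1 ≤ N) (hΩ : Bornology.IsBounded Ω) :
    ∃ C : ℝ, ∀ w ∈ H01Submodule Ω, ‖w.1‖ ≤ C * ‖w.2‖ := by
  have : Nonempty (Fin N) := ⟨⟨0, hN⟩⟩
  obtain ⟨C, hC⟩ := exists_lintegral_sq_le_lintegral_fderiv_sq
    (μ := (volume : Measure (EuclideanSpace ℝ (Fin N)))) hΩ
  refine ⟨C, fun w hw => ?_⟩
  have hclosed : IsClosed {w : L2 Ω × L2Vec Ω | ‖w.1‖ ≤ C * ‖w.2‖} :=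
    isClosed_le (by fun_prop) (by fun_prop)
  refine closure_minimal ?_ hclosed (mem_closure_isTestPair hw)
  rintro v ⟨φ, hv⟩
  have h := hC φ (hv.1.smooth.of_le (by simp))
    ((subset_tsupport _).trans hv.1.support_subset)
  rw [← hv.enorm_fst_sq, ← hv.enorm_snd_sq, ← mul_pow] at h
  have h' := (ENNReal.pow_le_pow_left_iff two_ne_zero).1 h
  simp only [enorm_eq_nnnorm] at h'
  exact_mod_cast h'

/-- Rellich's theorem: weak convergence in `H₀¹(Ω)` implies strong convergence in `L²(Ω)`. -/
theorem WeaklyConverges.tendsto_toL2 (hN : 1 ≤ N) (hΩ : Bornology.IsBounded Ω)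
    {y : ℕ → H01 Ω} {y₀ : H01 Ω} (hy : WeaklyConverges y y₀) :
    Tendsto (fun n => H01.toL2 (y n)) atTop (𝓝 (H01.toL2 y₀)) := by
  have : Nonempty (Fin N) := ⟨⟨0, hN⟩⟩
  obtain ⟨C, hC⟩ := exists_norm_fst_le_norm_snd hN hΩ
  let T : H01 Ω →L[ℝ] L2 Ω := LinearMap.mkContinuous H01.toL2 C fun u => hC _ u.2
  let D : H01 Ω →L[ℝ] L2Vec Ω := LinearMap.mkContinuous H01.grad 1 fun u => by
    rw [one_mul]; exact le_rfl
  have hT : ∀ g : L2 Ω, Tendsto (fun n => inner ℝ g (T (y n - y₀))) atTop (𝓝 0) := fun g => by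
    have h := (hy ((innerSL ℝ g).comp T)).sub_const (((innerSL ℝ g).comp T) y₀)
    rw [sub_self] at h
    refine h.congr fun n => ?_
    rw [← map_sub]
    rfl
  -- Uniform boundedness is applied to the gradients, viewed as functionals on the complete space
  -- `L2Vec Ω`; completeness of `H01 Ω` is not needed.
  obtain ⟨M, hM⟩ : ∃ M, ∀ n, ‖D (y n - y₀)‖ ≤ M := by
    have hb : ∀ g : L2Vec Ω, ∃ c, ∀ n, ‖innerSL ℝ (D (y n - y₀)) g‖ ≤ c := fun g => by
      have h := (hy ((innerSL ℝ g).comp D)).sub_const (((innerSL ℝ g).comp D) y₀)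
      obtain ⟨c, hc⟩ := h.norm.bddAbove_range
      refine ⟨c, fun n => le_trans (le_of_eq ?_) (hc (mem_range_self n))⟩
      rw [← map_sub, innerSL_apply_apply, real_inner_comm]
      rfl
    obtain ⟨M, hM⟩ := banach_steinhaus hb
    exact ⟨M, fun n => by simpa only [innerSL_apply_norm] using hM n⟩
  have hpos : ∀ n : ℕ, (0 : ℝ) < 1 / (n + 1) := fun n => Nat.one_div_pos_of_nat
  -- Replacing `y n - y₀` by a test pair with vanishing error keeps the weak limit zero in `L²` and
  -- the gradients bounded.
  have hex : ∀ n, ∃ v : L2 Ω × L2Vec Ω, (∃ φ, IsTestPair φ v) ∧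
      ‖T (y n - y₀) - v.1‖ ≤ 1 / ((n : ℝ) + 1) ∧ ‖D (y n - y₀) - v.2‖ ≤ 1 / ((n : ℝ) + 1) :=
    fun n => by
      obtain ⟨v, hv, hd⟩ := Metric.mem_closure_iff.1
        (mem_closure_isTestPair (y n - y₀ : H01 Ω).2) _ (hpos n)
      rw [dist_eq_norm, Prod.norm_def] at hd
      exact ⟨v, hv, (le_max_left _ _).trans hd.le, (le_max_right _ _).trans hd.le⟩
  choose v hv hv1 hv2 using hex
  choose φ hφ using hv
  have herr : Tendsto (fun n => T (y n - y₀) - (v n).1) atTop (𝓝 0) :=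
    squeeze_zero_norm hv1 tendsto_one_div_add_atTop_nhds_zero_nat
  have hinner : ∀ g : L2 Ω, Tendsto (fun n => inner ℝ g (v n).1) atTop (𝓝 0) := fun g => by
    have h := (hT g).sub (((innerSL ℝ g).continuous.tendsto 0).comp herr)
    rw [map_zero, sub_zero] at h
    refine h.congr fun n => ?_
    simp [inner_sub_right]
  have hgrad : ∀ n, ‖(v n).2‖ ≤ M + 1 := fun n => by
    have h1 : 1 / ((n : ℝ) + 1) ≤ 1 := by
      rw [div_le_one (by positivity)]
      linarith [n.cast_nonneg (α := ℝ)]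
    have h2 := norm_sub_le (D (y n - y₀)) (D (y n - y₀) - (v n).2)
    rw [sub_sub_cancel] at h2
    linarith [hM n, hv2 n]
  have hball : ∀ x δ, Tendsto (fun n => ∫ z in Metric.ball x δ, φ n z) atTop (𝓝 0) := fun x δ => by
    have hfin : volume.restrict Ω (Metric.ball x δ) ≠ ⊤ :=
      ((Measure.restrict_apply_le _ _).trans_lt measure_ball_lt_top).ne
    -- Integrals over balls are pairings with indicators, hence visible to weak convergence.
    refine (hinner (indicatorConstLp 2 measurableSet_ball hfin 1)).congr fun n => ?_
    rw [L2.inner_indicatorConstLp_one, Measure.restrict_restrict measurableSet_ball,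
      integral_congr_ae (ae_mono (Measure.restrict_mono inter_subset_right le_rfl) (hφ n).2.1)]
    refine (setIntegral_eq_of_subset_of_forall_sdiff_eq_zero measurableSet_ball inter_subset_left
      fun z hz => ?_).symm
    by_contra hne
    exact hz.2 ⟨hz.1, (hφ n).1.support_subset (subset_tsupport _ hne)⟩
  have hlim := tendsto_lintegral_sq_of_tendsto_integral_ball (μ := volume) hΩ
    (fun n => (hφ n).1.smooth.of_le (by simp)) (fun n => (hφ n).1.compactSupport)
    (fun n => (subset_tsupport _).trans (hφ n).1.support_subset)
    (K := (M + 1).toNNReal ^ 2) (fun n => by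
      rw [← (hφ n).enorm_snd_sq, ENNReal.coe_pow]
      gcongr
      rw [← ofReal_norm]
      exact ENNReal.ofReal_le_ofReal (hgrad n)) hball
  have hv0 : Tendsto (fun n => (v n).1) atTop (𝓝 0) := by
    rw [tendsto_zero_iff_enorm_tendsto_zero]
    simp_rw [← fun n => (hφ n).enorm_fst_sq] at hlim
    have hsqrt : ∀ a : ENNReal, (a ^ 2) ^ (1 / 2 : ℝ) = a := fun a => by
      rw [← ENNReal.rpow_natCast, ← ENNReal.rpow_mul]
      simp
    have h := ((ENNReal.continuous_rpow_const (y := 1 / 2)).tendsto 0).comp hlim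
    rw [ENNReal.zero_rpow_of_pos (by norm_num)] at h
    exact h.congr fun n => hsqrt _
  have := (herr.add hv0).add_const (T y₀)
  simp only [sub_add_cancel, map_sub, zero_add] at this
  exact this

end Sobolev

/-! ### The three assertions -/

theorem mainTheorem12 {N : ℕ} (hN : 1 ≤ N) (Ω : Set (EuclideanSpace ℝ (Fin N)))
    (hΩo : IsOpen Ω) (hΩb : Bornology.IsBounded Ω)
    (p : ℝ) (hp : 2 ≤ p) (k : ℕ) (Φ : ℝ → ℝ) (hΦ : IsTruncation k Φ) (ε : ℝ) (hε : 0 < ε) :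
    IsBoundedOperator (fun w : H01 Ω × L2 Ω => FOperator hp hε hΦ w.1 w.2) ∧
    (∀ y : H01 Ω, IsStrictlyMonotoneOperator (fun z : L2 Ω => FOperator hp hε hΦ y z) ∧
      IsRadiallyContinuous (fun z : L2 Ω => FOperator hp hε hΦ y z)) ∧
    (∀ (z : L2 Ω) (y : ℕ → H01 Ω) (y₀ : H01 Ω), WeaklyConverges y y₀ →
      Tendsto (fun n => FOperator hp hε hΦ (y n) z) atTop (𝓝 (FOperator hp hε hΦ y₀ z))) := by
  obtain ⟨C, hC⟩ := hΦ.exists_lipschitzWith_regPower (p := p) hε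
  have hcont : Continuous (hC.compLp regPower_zero : L2 Ω → L2 Ω) :=
    hC.continuous_compLp regPower_zero
  simp only [FOperator_eq_compLp hp hε hΦ hC]
  refine ⟨fun S hS => ?_, fun y => ⟨?_, ?_⟩, fun z y y₀ hy => ?_⟩
  · obtain ⟨R, hR⟩ := hS.exists_norm_le
    obtain ⟨A, hA⟩ := exists_norm_fst_le_norm_snd hN hΩb
    refine isBounded_iff_forall_norm_le.2 ⟨C * (|A| * R) + C * R, ?_⟩
    rintro _ ⟨⟨y, z⟩, hw, rfl⟩
    have hy : ‖y‖ ≤ R := (norm_fst_le (y, z)).trans (hR _ hw)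
    have hz : ‖z‖ ≤ R := (norm_snd_le (y, z)).trans (hR _ hw)
    have hy' : ‖H01.toL2 y‖ ≤ |A| * R :=
      (hA _ y.2).trans (mul_le_mul (le_abs_self A) hy (norm_nonneg _) (abs_nonneg A))
    refine (norm_add_le _ _).trans (add_le_add ?_ ?_)
    · exact (hC.norm_compLp_le regPower_zero _).trans (by gcongr)
    · exact (hC.norm_compLp_le regPower_zero _).trans (by gcongr)
  · refine isStrictlyMonotoneOperator_of_strictMono (hΦ.strictMono_regPower hp hε)
      fun z₁ z₂ => ?_
    -- The `y`-term cancels in the difference.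
    rw [add_sub_add_left_eq_sub]
    filter_upwards [Lp.coeFn_sub (hC.compLp regPower_zero z₁) (hC.compLp regPower_zero z₂),
      hC.coeFn_compLp regPower_zero z₁, hC.coeFn_compLp regPower_zero z₂] with x h1 h2 h3
    rw [h1, Pi.sub_apply, h2, h3]
    rfl
  · exact IsRadiallyContinuous.of_continuous (continuous_const.add hcont)
  · exact ((hcont.tendsto _).comp (hy.tendsto_toL2 hN hΩb)).add_const _
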